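/- Setting. Let $d\ge 1$ and let $\Omega\subset\mathbb{R}^d$ be a non-empty convex bounded open set with $C^\infty$ boundary. Let $f\in L^\infty(\Omega)$, $g\in H^{1/2}(\partial\Omega)$, $w\in L^\infty(\Omega)$ with $w\ge c_w$ a.e. for a constant $c_w>0$, and let $\alpha\ge 0$, $\beta>0$. Let $T_0:H^1(\Omega)\to L^2(\partial\Omega)$ be the trace operator. Let $u_R\in H^1(\Omega)$ be the weak solution of the Robin problem $-\Delta u+wu=f$ in $\Omega$, $\alpha u+\beta\,\partial u/\partial n=g$ on $\partial\Omega$, that is, $$(\nabla u_R,\nabla v)+(wu_R,v)+\tfrac{\alpha}{\beta}(T_0u_R,T_0v)_{L^2(\partial\Omega)}=(f,v)+\tfrac1\beta(g,T_0v)_{L^2(\partial\Omega)}\qquad\forall v\in H^1(\Omega),$$ and let $u_D\in H^1_0(\Omega)$ be the weak solution of the Dirichlet problem, $(\nabla u_D,\nabla v)+(wu_D,v)=(f,v)$ for all $v\in H^1_0(\Omega)$. For $u\in H^1(\Omega)$ put $$\mathcal{L}(u)=\int_\Omega\Big(\tfrac12|\nabla u|^2+\tfrac12wu^2-fu\Big)dx+\frac1\beta\int_{\partial\Omega}\Big(\tfrac\alpha2(T_0u)^2-g\,T_0u\Big)ds,$$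 and, for i.i.d. uniform samples $X_1,\dots,X_N$ on $\Omega$ and i.i.d. uniform samples $Y_1,\dots,Y_M$ on $\partial\Omega$ ($N,M\ge1$), $$\widehat{\mathcal{L}}(u)=\frac{|\Omega|}{N}\sum_{i=1}^N\Big(\tfrac12|\nabla u(X_i)|^2+\tfrac12w(X_i)u(X_i)^2-f(X_i)u(X_i)\Big)+\frac{|\partial\Omega|}{\beta M}\sum_{j=1}^M\Big(\tfrac\alpha2(T_0u)(Y_j)^2-g(Y_j)(T_0u)(Y_j)\Big).$$ Here $f,g,w$ are fixed functions, and every $u$ in the class $\mathcal P$ below comes with fixed representatives of $u$, $\nabla u$ and $T_0u$, at which the point evaluations are made. Let $\mathcal{P}\subset H^1(\Omega)$ be any class of functions, let $\widehat u_\phi\in\mathcal P$ be a minimizer of $\widehat{\mathcal L}$ over $\mathcal P$, and let $u_{\phi_{\mathcal A}}\in\mathcal{P}$ be the output of any (random) solver. Statement. There are a constant $C(coe)$ depending only on $\|f\|_{L^\infty(\Omega)}$, $\|g\|_{H^{1/2}(\partial\Omega)}$, $\|w\|_{L^\infty(\Omega)}$, $c_w$, and a constant $C(\Omega,coe,\alpha)$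 depending only on these four numbers, $\Omega$ and $\alpha$, such that, for every realization of the samples and of the solver: (1) $$\|u_{\phi_{\mathcal A}}-u_R\|_{H^1(\Omega)}\le C(coe)\,\big[\mathcal E_{app}+\mathcal E_{sta}+\mathcal E_{opt}\big]^{1/2},$$ where $$\mathcal E_{app}=\max\{1,\tfrac1\beta\}\,C(\Omega,coe,\alpha)\inf_{\bar u\in\mathcal P}\|\bar u-u_R\|^2_{H^1(\Omega)},$$ $$\mathcal E_{sta}=\sup_{u\in\mathcal P}\big[\mathcal L(u)-\widehat{\mathcal L}(u)\big]+\sup_{u\in\mathcal P}\big[\widehat{\mathcal L}(u)-\mathcal L(u)\big]\in[0,+\infty],\qquad \mathcal E_{opt}=\widehat{\mathcal L}(u_{\phi_{\mathcal A}})-\widehat{\mathcal L}(\widehat u_\phi).$$ In particular, for $0<\beta\le1$ the factor $\max\{1,1/\beta\}$ equals $1/\beta$. (2) If $\alpha=1$ and $g=0$ on $\partial\Omega$, then $$\|u_{\phi_{\mathcal A}}-u_D\|_{H^1(\Omega)}\le C(coe)\,\big[\mathcal E_{app}+\mathcal E_{sta}+\mathcal E_{opt}+\|u_R-u_D\|^2_{H^1(\Omega)}\big]^{1/2}.$$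 -/

import Mathlib

open MeasureTheory ProbabilityTheory Filter Topology
open scoped ContDiff NNReal ENNReal InnerProductSpace

noncomputable section

namespace DeepRitz

/-- Euclidean space `ℝ^d`. -/
abbrev Euc (d : ℕ) : Type := EuclideanSpace ℝ (Fin d)

variable {d : ℕ}

/-- Lebesgue measure on `Ω`. -/
abbrev domainMeasure (Ω : Set (Euc d)) : Measure (Euc d) := volume.restrict Ω

/-- Surface measure on `∂Ω`: the `(d-1)`-dimensional Hausdorff measure, normalised so that it
agrees with Lebesgue measure on `ℝ^(d-1)`, restricted to the boundary. -/
def surfaceMeasure (Ω : Set (Euc d)) : Measure (Euc d) :=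
  (Measure.euclideanHausdorffMeasure (d - 1) : Measure (Euc d)).restrict (frontier Ω)

/-- `∂Ω` is of class `C^∞`: near each boundary point `Ω` is the set `{ρ < 0}` for a smooth `ρ`
whose derivative does not vanish at that point. -/
def HasSmoothBoundary (Ω : Set (Euc d)) : Prop :=
  ∀ x ∈ frontier Ω, ∃ U ∈ 𝓝 x, ∃ ρ : Euc d → ℝ,
    ContDiff ℝ ∞ ρ ∧ fderiv ℝ ρ x ≠ 0 ∧ ∀ y ∈ U, (y ∈ Ω ↔ ρ y < 0)

/-- Convex bounded non-empty open sets with `C^∞` boundary. -/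
structure IsAdmissibleDomain (Ω : Set (Euc d)) : Prop where
  nonempty : Ω.Nonempty
  isOpen : IsOpen Ω
  convex : Convex ℝ Ω
  isBounded : Bornology.IsBounded Ω
  smooth : HasSmoothBoundary Ω

/-- Test functions on `Ω`: the space `C_c^∞(Ω)`. -/
structure IsTestFunction (Ω : Set (Euc d)) (φ : Euc d → ℝ) : Prop where
  contDiff : ContDiff ℝ ∞ φ
  hasCompactSupport : HasCompactSupport φ
  tsupport_subset : tsupport φ ⊆ Ω

/-- `G` is the weak (distributional) gradient of `u` on `Ω`. -/
def IsWeakGradient (Ω : Set (Euc d)) (u : Euc d → ℝ) (G : Euc d → Euc d) : Prop :=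
  ∀ φ : Euc d → ℝ, IsTestFunction Ω φ →
    ∫ x in Ω, u x • gradient φ x = -∫ x in Ω, φ x • G x

/-- The functions `φ n` (with their classical gradients) converge in `H¹(Ω)` to the function `u`
with weak gradient `G`. -/
def TendstoH1 (Ω : Set (Euc d)) (φ : ℕ → Euc d → ℝ) (u : Euc d → ℝ) (G : Euc d → Euc d) : Prop :=
  Tendsto (fun n => eLpNorm (fun x => φ n x - u x) 2 (domainMeasure Ω)) atTop (𝓝 0) ∧
  Tendsto (fun n => eLpNorm (fun x => gradient (φ n) x - G x) 2 (domainMeasure Ω)) atTop (𝓝 0)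

/-- `h = T₀ u`, where `T₀` is the zero order trace operator, that is, the continuous extension
`H¹(Ω) → L²(∂Ω)` of the restriction map `φ ↦ φ|_∂Ω` on functions smooth up to the boundary. -/
def IsTrace (Ω : Set (Euc d)) (u : Euc d → ℝ) (G : Euc d → Euc d) (h : Euc d → ℝ) : Prop :=
  ∃ φ : ℕ → Euc d → ℝ, (∀ n, ContDiff ℝ ∞ (φ n)) ∧ TendstoH1 Ω φ u G ∧
    Tendsto (fun n => eLpNorm (fun x => φ n x - h x) 2 (surfaceMeasure Ω)) atTop (𝓝 0)

/-- An element of `H¹(Ω)`, together with representatives of its weak gradient (an element of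
`L²(Ω)`) and of its trace (an element of `L²(∂Ω)`). Gradient and trace are determined up to null
sets by the function; the chosen representatives are the ones that point evaluations
`u(x)`, `∇u(x)`, `T₀u(y)` refer to. The values of `toFun` and `grad` outside `Ω`, and of `trace`
outside `∂Ω`, play no role. -/
structure H1Function (Ω : Set (Euc d)) where
  toFun : Euc d → ℝ
  grad : Euc d → Euc d
  trace : Euc d → ℝ
  memLp_toFun : MemLp toFun 2 (domainMeasure Ω)
  memLp_grad : MemLp grad 2 (domainMeasure Ω)
  memLp_trace : MemLp trace 2 (surfaceMeasure Ω)
  isWeakGradient : IsWeakGradient Ω toFun grad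
  isTrace : IsTrace Ω toFun grad trace

/-- `‖u - v‖_{H¹(Ω)}`. -/
def h1Dist {Ω : Set (Euc d)} (u v : H1Function Ω) : ℝ :=
  Real.sqrt ((∫ x in Ω, (u.toFun x - v.toFun x) ^ 2) + ∫ x in Ω, ‖u.grad x - v.grad x‖ ^ 2)

/-- `u ∈ H₀¹(Ω)`, the closure of `C_c^∞(Ω)` in `H¹(Ω)`. -/
def MemH10 {Ω : Set (Euc d)} (u : H1Function Ω) : Prop :=
  ∃ φ : ℕ → Euc d → ℝ, (∀ n, IsTestFunction Ω (φ n)) ∧ TendstoH1 Ω φ u.toFun u.grad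

/-- `‖h‖_{L^∞(Ω)}`. -/
def linftyNorm (Ω : Set (Euc d)) (h : Euc d → ℝ) : ℝ := (eLpNorm h ⊤ (domainMeasure Ω)).toReal

/-- The square of the Gagliardo seminorm of `H^{1/2}(∂Ω)`:
`∫_∂Ω ∫_∂Ω |g(x) - g(y)|² / |x - y|^d ds(y) ds(x)`; the exponent is `(d - 1) + 2 · (1/2)`. -/
def gagliardoSq (Ω : Set (Euc d)) (g : Euc d → ℝ) : ℝ≥0∞ :=
  ∫⁻ x, ∫⁻ y, ENNReal.ofReal (|g x - g y| ^ 2 / ‖x - y‖ ^ d) ∂(surfaceMeasure Ω) ∂(surfaceMeasure Ω)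

/-- `g ∈ H^{1/2}(∂Ω)`. -/
def MemHHalf (Ω : Set (Euc d)) (g : Euc d → ℝ) : Prop :=
  MemLp g 2 (surfaceMeasure Ω) ∧ gagliardoSq Ω g < ⊤

/-- `‖g‖_{H^{1/2}(∂Ω)}`. -/
def hHalfNorm (Ω : Set (Euc d)) (g : Euc d → ℝ) : ℝ :=
  Real.sqrt ((∫ y, g y ^ 2 ∂(surfaceMeasure Ω)) + (gagliardoSq Ω g).toReal)

/-- The assumption on the data of the equation: `f ∈ L^∞(Ω)`, `g ∈ H^{1/2}(∂Ω)`, `w ∈ L^∞(Ω)`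
and `w ≥ c_w` almost everywhere in `Ω`, with `c_w > 0`. -/
structure AssumptionA (Ω : Set (Euc d)) (f g w : Euc d → ℝ) (cw : ℝ) : Prop where
  memLp_f : MemLp f ⊤ (domainMeasure Ω)
  memHHalf_g : MemHHalf Ω g
  memLp_w : MemLp w ⊤ (domainMeasure Ω)
  cw_pos : 0 < cw
  cw_le : ∀ᵐ x ∂(domainMeasure Ω), cw ≤ w x

/-- `u ∈ H¹(Ω)` is the weak solution of `-Δu + wu = f` in `Ω`, `αu + β ∂u/∂n = g` on `∂Ω`:
`(∇u,∇v) + (wu,v) + (α/β)(T₀u,T₀v)_∂Ω = (f,v) + (1/β)(g,T₀v)_∂Ω` for all `v ∈ H¹(Ω)`. -/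
def IsRobinSolution (Ω : Set (Euc d)) (f g w : Euc d → ℝ) (α β : ℝ) (u : H1Function Ω) : Prop :=
  ∀ v : H1Function Ω,
    (∫ x in Ω, ⟪u.grad x, v.grad x⟫_ℝ) + (∫ x in Ω, w x * u.toFun x * v.toFun x)
        + α / β * ∫ y, u.trace y * v.trace y ∂(surfaceMeasure Ω)
      = (∫ x in Ω, f x * v.toFun x) + 1 / β * ∫ y, g y * v.trace y ∂(surfaceMeasure Ω)

/-- `u ∈ H₀¹(Ω)` is the weak solution of `-Δu + wu = f` in `Ω`, `u = 0` on `∂Ω`: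
`(∇u,∇v) + (wu,v) = (f,v)` for all `v ∈ H₀¹(Ω)`. -/
def IsDirichletSolution (Ω : Set (Euc d)) (f w : Euc d → ℝ) (u : H1Function Ω) : Prop :=
  MemH10 u ∧ ∀ v : H1Function Ω, MemH10 v →
    (∫ x in Ω, ⟪u.grad x, v.grad x⟫_ℝ) + (∫ x in Ω, w x * u.toFun x * v.toFun x)
      = ∫ x in Ω, f x * v.toFun x

/-- The integrand `½|∇u|² + ½wu² - fu` of the energy in the interior. -/
def interiorDensity {Ω : Set (Euc d)} (f w : Euc d → ℝ) (u : H1Function Ω) (x : Euc d) : ℝ :=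
  1 / 2 * ‖u.grad x‖ ^ 2 + 1 / 2 * w x * u.toFun x ^ 2 - f x * u.toFun x

/-- The integrand `(α/2)(T₀u)² - g T₀u` of the energy on the boundary. -/
def boundaryDensity {Ω : Set (Euc d)} (g : Euc d → ℝ) (α : ℝ) (u : H1Function Ω) (y : Euc d) : ℝ :=
  α / 2 * u.trace y ^ 2 - g y * u.trace y

/-- The energy functional `𝓛`. -/
def energy {Ω : Set (Euc d)} (f g w : Euc d → ℝ) (α β : ℝ) (u : H1Function Ω) : ℝ :=
  (∫ x in Ω, interiorDensity f w u x)
    + 1 / β * ∫ y, boundaryDensity g α u y ∂(surfaceMeasure Ω)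

/-- The empirical energy functional `𝓛̂` at the sample points `x₁, …, x_N` and `y₁, …, y_M`. -/
def empiricalEnergy {Ω : Set (Euc d)} (f g w : Euc d → ℝ) (α β : ℝ) {N M : ℕ}
    (x : Fin N → Euc d) (y : Fin M → Euc d) (u : H1Function Ω) : ℝ :=
  volume.real Ω / N * (∑ i, interiorDensity f w u (x i))
    + (surfaceMeasure Ω).real Set.univ / (β * M) * ∑ j, boundaryDensity g α u (y j)

/-- `X₁, …, X_N` are i.i.d. uniformly distributed on `Ω` and `Y₁, …, Y_M` are i.i.d. uniformly
distributed on `∂Ω` (with respect to Lebesgue and surface measure). -/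
structure IsUniformSample (Ω : Set (Euc d)) {S : Type*} [MeasurableSpace S] (Pr : Measure S)
    {N M : ℕ} (X : Fin N → S → Euc d) (Y : Fin M → S → Euc d) : Prop where
  measurable_X : ∀ i, Measurable (X i)
  measurable_Y : ∀ j, Measurable (Y j)
  iIndepFun_X : iIndepFun X Pr
  iIndepFun_Y : iIndepFun Y Pr
  uniform_X : ∀ i, pdf.IsUniform (X i) Ω Pr volume
  uniform_Y : ∀ j, pdf.IsUniform (Y j) (frontier Ω) Pr (surfaceMeasure Ω)

/-- The approximation error `max(1, 1/β) · C · inf_{ū ∈ P} ‖ū - u_R‖²_{H¹(Ω)}`. -/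
def approxError {Ω : Set (Euc d)} (C β : ℝ) (P : Set (H1Function Ω)) (uR : H1Function Ω) : ℝ :=
  max 1 (1 / β) * C * ⨅ ubar : P, h1Dist ubar.1 uR ^ 2

/-- The statistical error `sup_{u ∈ P} [L(u) - L̂(u)] + sup_{u ∈ P} [L̂(u) - L(u)]`. The suprema
are extended real numbers, since they may be `+∞`. -/
def statError {Ω : Set (Euc d)} (P : Set (H1Function Ω)) (L Lhat : H1Function Ω → ℝ) : EReal :=
  (⨆ u ∈ P, ((L u - Lhat u : ℝ) : EReal)) + ⨆ u ∈ P, ((Lhat u - L u : ℝ) : EReal)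

/-- The square root of an extended real number, with values in `[0, ∞]`. -/
def sqrtE (a : EReal) : ℝ≥0∞ := a.toENNReal ^ (1 / 2 : ℝ)

end DeepRitz

end

open DeepRitz

/-!
The Robin solution `u_R` is the critical point of the quadratic energy `𝓛`, so the excess energy of
any `u` is half the squared energy norm of the difference (`energy_sub_energy`):
`𝓛(u) - 𝓛(u_R) = ½ ‖∇(u - u_R)‖² + ½ (w (u - u_R), u - u_R) + (α / 2β) ‖T₀(u - u_R)‖²`.
Since `w ≥ c_w`, it is at least `min(1, c_w) / 2` times `‖u - u_R‖²_{H¹}`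
(`le_energy_sub_energy`). Since `w` is bounded and the trace operator is continuous, it is at most
`max(1, 1/β) C ‖u - u_R‖²_{H¹}` (`energy_sub_energy_le`). Adding and subtracting empirical
energies, and using that `û_φ` minimises `𝓛̂`, bounds the excess energy of the solver's output by
the approximation, statistical and optimization errors (`coe_sub_le_errors`); part (1) follows.
Part (2) follows from the same bound by `‖a + b‖² ≤ 2 ‖a‖² + 2 ‖b‖²`.

The analytic ingredient is the trace inequality `‖T₀u‖_{L²(∂Ω)} ≤ C ‖u‖_{H¹(Ω)}`, with `∂Ω`
carrying the Hausdorff measure (`exists_integral_trace_sub_sq_le`). By the definition of the trace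
it suffices to treat smooth functions, and by compactness a neighbourhood of one boundary point
`x`. Let `e` be the unit vector pointing from `x` to the centre of a ball contained in `Ω`.
Convexity gives interior cones of axis `e` at the boundary points near `x`
(`add_smul_add_mem_of_convex`). Consequently the orthogonal projection along `e` is bi-Lipschitz on
that part of `∂Ω` (`dist_le_mul_dist_orthogonalProjection`), and the Hausdorff measure there
projects to a measure bounded by a multiple of Lebesgue measure on the hyperplane `eᗮ`
(`map_restrict_euclideanHausdorffMeasure_le`). The one-dimensional trace inequality on the segments
`b + t e` (`sq_le_integral_segment`), integrated over `b ∈ ∂Ω`, then yields the claim by Fubini's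
theorem (`exists_lintegral_slices_eq`).
-/

namespace DeepRitz

/-! ### The boundary of a convex set as a Lipschitz graph -/

section Geometry

variable {E : Type*} [NormedAddCommGroup E] [InnerProductSpace ℝ E]

/-- A convex open set containing `ball (x + s • e) r` contains, for every point `b` of its closure
near `x`, a truncated cone with vertex `b` and axis `e`. -/
lemma add_smul_add_mem_of_convex {Ω : Set E} (hc : Convex ℝ Ω) (ho : IsOpen Ω) {x e : E} {s r : ℝ}
    (hs : 0 < s) (hball : Metric.ball (x + s • e) r ⊆ Ω) {b : E} (hb : b ∈ closure Ω)
    (hbx : dist b x < r / 2) {t : ℝ} (ht : 0 < t) (hts : t ≤ s) {v : E}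
    (hv : s * ‖v‖ < t * (r / 2)) : b + t • e + v ∈ Ω := by
  -- The point in question is the combination of `b` and this interior point with weight `t / s`.
  have hc' : b + s • e + (s / t) • v ∈ interior Ω := by
    rw [ho.interior_eq]
    apply hball
    rw [Metric.mem_ball, dist_eq_norm]
    have h1 : b + s • e + (s / t) • v - (x + s • e) = (b - x) + (s / t) • v := by abel
    have h2 : ‖(s / t) • v‖ < r / 2 := by
      rw [norm_smul, Real.norm_of_nonneg (by positivity), div_mul_eq_mul_div, div_lt_iff₀ ht]
      linarith
    rw [dist_eq_norm] at hbx
    rw [h1]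
    linarith [norm_add_le (b - x) ((s / t) • v)]
  have h := hc.combo_interior_closure_mem_interior hc' hb (a := t / s) (b := 1 - t / s)
    (by positivity) (by rw [sub_nonneg, div_le_one hs]; exact hts) (by ring)
  rw [ho.interior_eq] at h
  convert h using 1
  have h3 : t / s * (s / t) = 1 := by field_simp
  have h4 : t / s * s = t := by field_simp
  rw [smul_add, smul_add, smul_smul, smul_smul, h3, h4]
  module

/-- Near `x`, the boundary of a convex open set is a Lipschitz graph over the hyperplane orthogonal
to a direction `e` that points from `x` into the interior: the orthogonal projection along `e` is
injective there, with Lipschitz inverse. -/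
lemma dist_le_mul_dist_orthogonalProjection {Ω : Set E} (hc : Convex ℝ Ω) (ho : IsOpen Ω)
    {x e : E} (he : ‖e‖ = 1) {s r : ℝ} (hr : 0 < r) (hrs : r ≤ s)
    (hball : Metric.ball (x + s • e) r ⊆ Ω) {y z : E}
    (hy : y ∈ frontier Ω ∩ Metric.ball x (r / 2)) (hz : z ∈ frontier Ω ∩ Metric.ball x (r / 2)) :
    dist y z ≤ (2 * s / r + 1) * dist ((ℝ ∙ e)ᗮ.orthogonalProjectionOnto y)
      ((ℝ ∙ e)ᗮ.orthogonalProjectionOnto z) := by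
  have hs : 0 < s := hr.trans_le hrs
  have key : ∀ y z : E, y ∈ frontier Ω ∩ Metric.ball x (r / 2) →
      z ∈ frontier Ω ∩ Metric.ball x (r / 2) → ⟪e, z - y⟫_ℝ ≤
        2 * s / r * ‖(ℝ ∙ e)ᗮ.orthogonalProjectionOnto (z - y)‖ := by
    intro y z hy hz
    set v := (ℝ ∙ e)ᗮ.orthogonalProjectionOnto (z - y) with hv
    set t := ⟪e, z - y⟫_ℝ with ht
    rcases le_or_gt t 0 with h0 | h0
    · exact h0.trans (by positivity)
    have hdec : z = y + t • e + (v : E) := by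
      have h1 := (ℝ ∙ e).starProjection_add_starProjection_orthogonal (z - y)
      rw [Submodule.starProjection_unit_singleton ℝ he] at h1
      rw [add_assoc]
      exact (eq_add_of_sub_eq' h1.symm)
    have hts : t ≤ s := by
      have h1 : t ≤ ‖e‖ * ‖z - y‖ := real_inner_le_norm _ _
      rw [he, one_mul, ← dist_eq_norm] at h1
      have h2 := dist_triangle_right z y x
      have h3 := hy.2
      have h4 := hz.2
      rw [Metric.mem_ball] at h3 h4
      linarith
    -- Otherwise `z` would lie in the cone at `y`, hence in the open set `Ω`.
    by_contra! hcon
    have hzΩ : z ∈ Ω := by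
      rw [hdec]
      refine add_smul_add_mem_of_convex hc ho hs hball hy.1.1 hy.2 h0 hts ?_
      rw [div_mul_eq_mul_div, div_lt_iff₀ hr] at hcon
      rw [Submodule.coe_norm] at hcon
      linarith
    exact hz.1.2 (by rwa [ho.interior_eq])
  have h1 := key y z hy hz
  have h2 := key z y hz hy
  have hn : ‖(ℝ ∙ e)ᗮ.orthogonalProjectionOnto (y - z)‖
      = ‖(ℝ ∙ e)ᗮ.orthogonalProjectionOnto (z - y)‖ := by
    rw [← neg_sub z y, map_neg, norm_neg]
  have hi : ⟪e, y - z⟫_ℝ = -⟪e, z - y⟫_ℝ := by rw [← neg_sub z y, inner_neg_right]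
  rw [dist_comm y z, dist_comm (Submodule.orthogonalProjectionOnto _ y),
    dist_eq_norm, dist_eq_norm, ← map_sub]
  rw [hn, hi] at h2
  have h3 : ‖z - y‖ ≤ |⟪e, z - y⟫_ℝ| + ‖(ℝ ∙ e)ᗮ.orthogonalProjectionOnto (z - y)‖ := by
    have h4 := (ℝ ∙ e).starProjection_add_starProjection_orthogonal (z - y)
    rw [Submodule.starProjection_unit_singleton ℝ he] at h4
    calc ‖z - y‖ = ‖⟪e, z - y⟫_ℝ • e + (ℝ ∙ e)ᗮ.starProjection (z - y)‖ := by rw [h4]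
      _ ≤ _ := (norm_add_le _ _).trans_eq (by
        rw [norm_smul, he, mul_one, Real.norm_eq_abs]; rfl)
  have h5 := abs_le.2 ⟨by linarith, h1⟩
  linarith

end Geometry

/-! ### Hausdorff measure under expanding maps -/

section HausdorffMeasure

variable {X Y : Type*} [EMetricSpace X] [MeasurableSpace X] [BorelSpace X]
  [EMetricSpace Y] [MeasurableSpace Y] [BorelSpace Y]

/-- If `f` is expanding up to a factor `K` on `s`, then it pushes the Hausdorff measure on `s`
forward to a measure dominated by the Hausdorff measure of the target. -/
lemma map_restrict_euclideanHausdorffMeasure_le (n : ℕ) {f : X → Y} (hf : Measurable f) {s : Set X}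
    {K : ℝ≥0} (h : ∀ y ∈ s, ∀ z ∈ s, edist y z ≤ K * edist (f y) (f z)) :
    ((Measure.euclideanHausdorffMeasure n).restrict s).map f
      ≤ ((K : ℝ≥0∞) ^ n) • (Measure.euclideanHausdorffMeasure n : Measure Y) := by
  refine Measure.le_iff.2 fun A hA => ?_
  rw [Measure.map_apply hf hA, Measure.restrict_apply (hf hA), Measure.smul_apply, smul_eq_mul]
  set B := f ⁻¹' A ∩ s
  rcases B.eq_empty_or_nonempty with hB | ⟨b₀, hb₀⟩
  · simp [hB]
  have : Nonempty X := ⟨b₀⟩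
  have hinj : Set.InjOn f B := by
    intro y hy z hz hyz
    have := h y hy.2 z hz.2
    rw [hyz, edist_self, mul_zero] at this
    exact edist_le_zero.1 this
  have hlip : LipschitzOnWith K (Function.invFunOn f B) (f '' B) := by
    rintro _ ⟨y, hy, rfl⟩ _ ⟨z, hz, rfl⟩
    rw [hinj.leftInvOn_invFunOn hy, hinj.leftInvOn_invFunOn hz]
    exact h y hy.2 z hz.2
  have h1 := hlip.hausdorffMeasure_image_le (d := n) (by positivity)
  rw [hinj.invFunOn_image subset_rfl, ENNReal.rpow_natCast] at h1
  have h2 : μH[n] (f '' B) ≤ μH[n] A := measure_mono (by rintro _ ⟨y, hy, rfl⟩; exact hy.1)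
  simp only [Measure.euclideanHausdorffMeasure_def, Measure.smul_apply, ENNReal.smul_def,
    smul_eq_mul]
  rw [mul_left_comm]
  gcongr
  exact h1.trans (by gcongr)

end HausdorffMeasure

/-! ### Slicing by parallel lines -/

section Slicing

variable {E : Type*} [NormedAddCommGroup E] [InnerProductSpace ℝ E] [FiniteDimensional ℝ E]

/-- The decomposition of a Euclidean space into the hyperplane orthogonal to a unit vector `e` and
the line spanned by `e`. -/
noncomputable def hyperplaneProdEquiv (e : E) (he : ‖e‖ = 1) : ((ℝ ∙ e)ᗮ × ℝ) ≃L[ℝ] E :=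
  LinearEquiv.toContinuousLinearEquiv
  { toFun := fun p => p.1 + p.2 • e
    map_add' := fun p q => by
      simp only [Prod.fst_add, Prod.snd_add, Submodule.coe_add]; module
    map_smul' := fun c p => by
      simp only [Prod.smul_fst, Prod.smul_snd, Submodule.coe_smul, RingHom.id_apply, smul_eq_mul]
      module
    invFun := fun z => ((ℝ ∙ e)ᗮ.orthogonalProjectionOnto z, ⟪e, z⟫_ℝ)
    left_inv := fun p => by
      have h1 : ⟪e, (p.1 : E)⟫_ℝ = 0 := Submodule.mem_orthogonal_singleton_iff_inner_right.1 p.1.2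
      ext1
      · have : (ℝ ∙ e)ᗮ.orthogonalProjectionOnto e = 0 :=
          Submodule.orthogonalProjectionOnto_orthogonalComplement_singleton_eq_zero e
        simp [map_add, map_smul, this]
      · simp [inner_add_right, inner_smul_right, h1, he]
    right_inv := fun z => by
      have h4 := (ℝ ∙ e).starProjection_add_starProjection_orthogonal z
      rw [Submodule.starProjection_unit_singleton ℝ he, add_comm] at h4
      exact h4 }

lemma hyperplaneProdEquiv_apply (e : E) (he : ‖e‖ = 1) (p : (ℝ ∙ e)ᗮ × ℝ) :
    hyperplaneProdEquiv e he p = p.1 + p.2 • e := rfl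

lemma hyperplaneProdEquiv_symm_apply (e : E) (he : ‖e‖ = 1) (z : E) :
    (hyperplaneProdEquiv e he).symm z = ((ℝ ∙ e)ᗮ.orthogonalProjectionOnto z, ⟪e, z⟫_ℝ) := rfl

/-- An integral over the line `b + ℝ e` depends only on the projection of `b` to `eᗮ`. -/
lemma lintegral_line_eq (e : E) (he : ‖e‖ = 1) (h : E → ℝ≥0∞) (b : E) :
    ∫⁻ t : ℝ, h (b + t • e)
      = ∫⁻ t : ℝ, h (((ℝ ∙ e)ᗮ.orthogonalProjectionOnto b : E) + t • e) := by
  have hb := (hyperplaneProdEquiv e he).apply_symm_apply b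
  rw [hyperplaneProdEquiv_symm_apply, hyperplaneProdEquiv_apply] at hb
  refine (lintegral_congr fun t => ?_).trans (lintegral_add_left_eq_self
    (fun t => h (((ℝ ∙ e)ᗮ.orthogonalProjectionOnto b : E) + t • e)) ⟪e, b⟫_ℝ)
  conv_lhs => rw [← hb]
  simp only [add_smul, add_assoc]

variable [MeasurableSpace E] [BorelSpace E]

/-- Fubini's theorem for slices in direction `e`, up to a constant factor. -/
lemma exists_lintegral_slices_eq (e : E) (he : ‖e‖ = 1) :
    ∃ c : ℝ≥0, ∀ h : E → ℝ≥0∞, Measurable h →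
      ∫⁻ p : (ℝ ∙ e)ᗮ, ∫⁻ t : ℝ, h (p + t • e) = c * ∫⁻ x, h x := by
  set T := hyperplaneProdEquiv e he
  set μ : Measure E := ((volume : Measure (ℝ ∙ e)ᗮ).prod (volume : Measure ℝ)).map T
  have : μ.IsAddHaarMeasure := T.isAddHaarMeasure_map _
  refine ⟨μ.addHaarScalarFactor volume, fun h hh => ?_⟩
  have hμ : μ = μ.addHaarScalarFactor volume • volume := Measure.isAddLeftInvariant_eq_smul _ _
  have h1 : ∫⁻ x, h x ∂μ = μ.addHaarScalarFactor volume * ∫⁻ x, h x := by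
    conv_lhs => rw [hμ]
    rw [lintegral_smul_measure]; rfl
  rw [← h1, lintegral_map hh T.continuous.measurable,
    lintegral_prod (fun p => h (T p)) (hh.comp T.continuous.measurable).aemeasurable]
  rfl

end Slicing

/-! ### The trace inequality for smooth functions -/

section Trace

variable {E : Type*} [NormedAddCommGroup E] [InnerProductSpace ℝ E]

/-- The one-dimensional trace inequality along the segment from `b` to `b + δ • e`. -/
lemma sq_le_integral_segment {φ : E → ℝ} (hφ : ContDiff ℝ 1 φ) (b : E) {e : E} (he : ‖e‖ = 1)
    {δ : ℝ} (hδ : 0 < δ) :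
    φ b ^ 2 ≤ ∫ t in (0 : ℝ)..δ,
      (1 / δ + 1) * (φ (b + t • e) ^ 2 + ‖fderiv ℝ φ (b + t • e)‖ ^ 2) := by
  have hline : Continuous fun t : ℝ => b + t • e := by fun_prop
  have hcφ : Continuous fun t : ℝ => φ (b + t • e) := hφ.continuous.comp hline
  have hcD : Continuous fun t : ℝ => fderiv ℝ φ (b + t • e) :=
    (hφ.continuous_fderiv one_ne_zero).comp hline
  have hder : ∀ t : ℝ, HasDerivAt (fun t : ℝ => φ (b + t • e)) (fderiv ℝ φ (b + t • e) e) t := by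
    intro t
    have h1 : HasDerivAt (fun t : ℝ => b + t • e) e t := by
      simpa using ((hasDerivAt_id t).smul_const e).const_add b
    exact ((hφ.differentiable one_ne_zero) _).hasFDerivAt.comp_hasDerivAt t h1
  -- The cutoff `t ↦ 1 - t / δ` removes the contribution of the far end of the segment.
  have hF : ∀ t : ℝ, HasDerivAt (fun t : ℝ => -((1 - t / δ) * φ (b + t • e) ^ 2))
      (1 / δ * φ (b + t • e) ^ 2
        - (1 - t / δ) * (2 * φ (b + t • e) * fderiv ℝ φ (b + t • e) e)) t := by
    intro t
    have h1 : HasDerivAt (fun t : ℝ => 1 - t / δ) (-(1 / δ)) t := by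
      simpa using ((hasDerivAt_id t).div_const δ).const_sub 1
    refine (h1.mul ((hder t).pow 2)).neg.congr_deriv ?_
    simp only [Pi.pow_apply]
    push_cast
    ring
  have hcF : Continuous fun t : ℝ => 1 / δ * φ (b + t • e) ^ 2
        - (1 - t / δ) * (2 * φ (b + t • e) * fderiv ℝ φ (b + t • e) e) := by fun_prop
  have hint := intervalIntegral.integral_eq_sub_of_hasDerivAt (a := 0) (b := δ)
    (fun t _ => hF t) (hcF.intervalIntegrable _ _)
  have h0 : φ b ^ 2 = ∫ t in (0 : ℝ)..δ, (1 / δ * φ (b + t • e) ^ 2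
        - (1 - t / δ) * (2 * φ (b + t • e) * fderiv ℝ φ (b + t • e) e)) := by
    rw [hint]
    simp [hδ.ne']
  rw [h0]
  refine intervalIntegral.integral_mono_on hδ.le (hcF.intervalIntegrable _ _)
    (Continuous.intervalIntegrable (by fun_prop) _ _) fun t ht => ?_
  set p := φ (b + t • e)
  have hq : |fderiv ℝ φ (b + t • e) e| ≤ ‖fderiv ℝ φ (b + t • e)‖ := by
    simpa [he] using (fderiv ℝ φ (b + t • e)).le_opNorm e
  set q := fderiv ℝ φ (b + t • e) e
  set D := ‖fderiv ℝ φ (b + t • e)‖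
  have hη0 : 0 ≤ 1 - t / δ := by rw [sub_nonneg, div_le_one hδ]; exact ht.2
  have hη1 : 1 - t / δ ≤ 1 := by rw [sub_le_self_iff]; exact div_nonneg ht.1 hδ.le
  have hpq : -(2 * p * q) ≤ p ^ 2 + D ^ 2 := by
    have : q ^ 2 ≤ D ^ 2 := sq_le_sq.2 (hq.trans (le_abs_self D))
    nlinarith [sq_nonneg (p + q)]
  have h1 : -((1 - t / δ) * (2 * p * q)) ≤ p ^ 2 + D ^ 2 :=
    calc -((1 - t / δ) * (2 * p * q)) = (1 - t / δ) * -(2 * p * q) := by ring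
      _ ≤ (1 - t / δ) * (p ^ 2 + D ^ 2) := by gcongr
      _ ≤ 1 * (p ^ 2 + D ^ 2) := by gcongr
      _ = _ := one_mul _
  have h2 : 0 ≤ 1 / δ * D ^ 2 := by positivity
  linarith

/-- The integrand `|φ|² + |∇φ|²` of the squared `H¹` norm of a differentiable function. -/
noncomputable def h1Density (φ : E → ℝ) (x : E) : ℝ≥0∞ := ‖φ x‖ₑ ^ 2 + ‖fderiv ℝ φ x‖ₑ ^ 2

lemma enorm_sq_le_lintegral_segment {φ : E → ℝ} (hφ : ContDiff ℝ 1 φ) (b : E) {e : E}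
    (he : ‖e‖ = 1) {δ : ℝ} (hδ : 0 < δ) :
    ‖φ b‖ₑ ^ 2 ≤ ENNReal.ofReal (1 / δ + 1) *
      ∫⁻ t in Set.Ioo 0 δ, h1Density φ (b + t • e) := by
  have hline : Continuous fun t : ℝ => b + t • e := by fun_prop
  have hcφ : Continuous fun t : ℝ => φ (b + t • e) := hφ.continuous.comp hline
  have hcD : Continuous fun t : ℝ => fderiv ℝ φ (b + t • e) :=
    (hφ.continuous_fderiv one_ne_zero).comp hline
  have hc : Continuous fun t : ℝ =>
    (1 / δ + 1) * (φ (b + t • e) ^ 2 + ‖fderiv ℝ φ (b + t • e)‖ ^ 2) := by fun_prop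
  have h := sq_le_integral_segment hφ b he hδ
  rw [intervalIntegral.integral_of_le hδ.le, integral_Ioc_eq_integral_Ioo] at h
  have h1 : ‖φ b‖ₑ ^ 2 = ENNReal.ofReal (φ b ^ 2) := by
    rw [← sq_abs, ENNReal.ofReal_pow (abs_nonneg _), ← Real.norm_eq_abs, ofReal_norm]
  rw [h1]
  refine (ENNReal.ofReal_le_ofReal h).trans_eq ?_
  rw [ofReal_integral_eq_lintegral_ofReal
    ((hc.integrableOn_Icc (a := 0) (b := δ)).mono_set Set.Ioo_subset_Icc_self)
    (ae_of_all _ fun t => by positivity), ← lintegral_const_mul' _ _ ENNReal.ofReal_ne_top]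
  refine lintegral_congr fun t => ?_
  rw [ENNReal.ofReal_mul (by positivity),
    ENNReal.ofReal_add (sq_nonneg (φ (b + t • e))) (sq_nonneg _), h1Density,
    ← sq_abs (φ _), ENNReal.ofReal_pow (abs_nonneg _),
    ENNReal.ofReal_pow (norm_nonneg _), ← Real.norm_eq_abs, ofReal_norm,
    ofReal_norm]

variable [MeasurableSpace E] [BorelSpace E]

lemma measurable_h1Density {φ : E → ℝ} (hφ : ContDiff ℝ 1 φ) : Measurable (h1Density φ) :=
  (hφ.continuous.enorm.measurable.pow_const 2).add
    ((hφ.continuous_fderiv one_ne_zero).enorm.measurable.pow_const 2)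

variable [FiniteDimensional ℝ E]

/-- Each boundary point of a convex open set has a neighbourhood where the trace inequality holds:
integrate the one-dimensional inequality over the boundary, which is there a Lipschitz graph over
a hyperplane, and use Fubini's theorem. -/
lemma exists_lintegral_frontier_inter_ball_le {Ω : Set E} (hc : Convex ℝ Ω) (ho : IsOpen Ω)
    (hne : Ω.Nonempty) {x : E} (hx : x ∈ frontier Ω) :
    ∃ ε > 0, ∃ C : ℝ≥0, ∀ φ : E → ℝ, ContDiff ℝ 1 φ →
      ∫⁻ b in frontier Ω ∩ Metric.ball x ε, ‖φ b‖ₑ ^ 2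
          ∂(Measure.euclideanHausdorffMeasure (Module.finrank ℝ E - 1))
        ≤ C * ∫⁻ z in Ω, h1Density φ z := by
  obtain ⟨x₀, hx₀⟩ := hne
  have hxΩ : x ∉ Ω := fun h => hx.2 (by rwa [ho.interior_eq])
  obtain ⟨r, hr, hball⟩ := Metric.isOpen_iff.1 ho x₀ hx₀
  set s := ‖x₀ - x‖
  have hrs : r ≤ s := by
    by_contra! hcon
    exact hxΩ (hball (by rwa [Metric.mem_ball, dist_comm, dist_eq_norm]))
  have hs : 0 < s := hr.trans_le hrs
  set e := s⁻¹ • (x₀ - x)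
  have he : ‖e‖ = 1 := by
    rw [norm_smul, norm_inv, norm_norm]; exact inv_mul_cancel₀ hs.ne'
  have hx₀e : x + s • e = x₀ := by
    simp only [e, smul_smul, mul_inv_cancel₀ hs.ne', one_smul]; abel
  have he0 : e ≠ 0 := fun h => by simp [h] at he
  rw [← hx₀e] at hball
  obtain ⟨c, hslice⟩ := exists_lintegral_slices_eq e he
  set K : ℝ≥0 := Real.toNNReal (2 * s / r + 1)
  set S := frontier Ω ∩ Metric.ball x (r / 2)
  have hfin : Module.finrank ℝ (ℝ ∙ e)ᗮ = Module.finrank ℝ E - 1 := by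
    have := (ℝ ∙ e).finrank_add_finrank_orthogonal
    rw [finrank_span_singleton he0] at this
    omega
  set n := Module.finrank ℝ E - 1
  set π := (ℝ ∙ e)ᗮ.orthogonalProjectionOnto
  have hmap : ((Measure.euclideanHausdorffMeasure n).restrict S).map π
      ≤ ((K : ℝ≥0∞) ^ n) • (volume : Measure (ℝ ∙ e)ᗮ) := by
    rw [← InnerProductSpace.euclideanHausdorffMeasure_eq_volume (V := (ℝ ∙ e)ᗮ), hfin]
    refine map_restrict_euclideanHausdorffMeasure_le n π.continuous.measurable fun y hy z hz => ?_
    rw [edist_dist, edist_dist, ← ENNReal.ofReal_coe_nnreal, ← ENNReal.ofReal_mul K.coe_nonneg,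
      Real.coe_toNNReal _ (by positivity)]
    exact ENNReal.ofReal_le_ofReal
      (dist_le_mul_dist_orthogonalProjection hc ho he hr hrs hball hy hz)
  refine ⟨r / 2, by positivity, Real.toNNReal (1 / r + 1) * (K ^ n * c), fun φ hφ => ?_⟩
  set h : E → ℝ≥0∞ := Ω.indicator (h1Density φ)
  have hh : Measurable h := (measurable_h1Density hφ).indicator ho.measurableSet
  have hH : Measurable fun p : (ℝ ∙ e)ᗮ => ∫⁻ t : ℝ, h (p + t • e) := by
    refine Measurable.lintegral_prod_right' (f := fun p : (ℝ ∙ e)ᗮ × ℝ => h (p.1 + p.2 • e)) ?_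
    exact hh.comp (hyperplaneProdEquiv e he).continuous.measurable
  have hSm : MeasurableSet S := isClosed_frontier.measurableSet.inter measurableSet_ball
  have hpt : ∀ b ∈ S, ‖φ b‖ₑ ^ 2 ≤
      ENNReal.ofReal (1 / r + 1) * ∫⁻ t : ℝ, h ((π b : E) + t • e) := by
    intro b hb
    refine (enorm_sq_le_lintegral_segment hφ b he hr).trans ?_
    refine mul_le_mul_right ?_ _
    rw [← lintegral_line_eq e he h b, ← lintegral_indicator measurableSet_Ioo]
    refine lintegral_mono fun t => ?_
    by_cases ht : t ∈ Set.Ioo 0 r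
    swap
    · simp [Set.indicator_of_notMem ht]
    rw [Set.indicator_of_mem ht]
    have hmem := add_smul_add_mem_of_convex hc ho hs hball hb.1.1 hb.2 ht.1 (ht.2.le.trans hrs)
      (v := 0) (by rw [norm_zero, mul_zero]; exact mul_pos ht.1 (by positivity))
    rw [add_zero] at hmem
    exact (Set.indicator_of_mem hmem _).ge
  calc ∫⁻ b in S, ‖φ b‖ₑ ^ 2 ∂(Measure.euclideanHausdorffMeasure n)
      ≤ ∫⁻ b in S, ENNReal.ofReal (1 / r + 1) * (∫⁻ t : ℝ, h ((π b : E) + t • e))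
          ∂(Measure.euclideanHausdorffMeasure n) := setLIntegral_mono' hSm hpt
    _ = ENNReal.ofReal (1 / r + 1) * ∫⁻ p : (ℝ ∙ e)ᗮ, (∫⁻ t : ℝ, h ((p : E) + t • e))
          ∂(((Measure.euclideanHausdorffMeasure n).restrict S).map π) := by
        rw [lintegral_const_mul' _ _ ENNReal.ofReal_ne_top,
          lintegral_map hH π.continuous.measurable]
    _ ≤ ENNReal.ofReal (1 / r + 1) * ∫⁻ p : (ℝ ∙ e)ᗮ, (∫⁻ t : ℝ, h ((p : E) + t • e))
          ∂(((K : ℝ≥0∞) ^ n) • (volume : Measure (ℝ ∙ e)ᗮ)) := by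
        gcongr
    _ = _ := by
        rw [lintegral_smul_measure, hslice h hh, lintegral_indicator ho.measurableSet]
        simp only [smul_eq_mul, ENNReal.coe_mul, ENNReal.coe_pow, mul_assoc]
        rfl

/-- The trace inequality for smooth functions on a bounded convex domain. -/
lemma exists_lintegral_frontier_le {Ω : Set E} (hc : Convex ℝ Ω) (ho : IsOpen Ω)
    (hne : Ω.Nonempty) (hb : Bornology.IsBounded Ω) :
    ∃ C : ℝ≥0, ∀ φ : E → ℝ, ContDiff ℝ 1 φ →
      ∫⁻ b in frontier Ω, ‖φ b‖ₑ ^ 2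
          ∂(Measure.euclideanHausdorffMeasure (Module.finrank ℝ E - 1))
        ≤ C * ∫⁻ z in Ω, h1Density φ z := by
  have hcomp : IsCompact (frontier Ω) :=
    Metric.isCompact_of_isClosed_isBounded isClosed_frontier
      (hb.closure.subset frontier_subset_closure)
  refine hcomp.induction_on (p := fun s => ∃ C : ℝ≥0, ∀ φ : E → ℝ, ContDiff ℝ 1 φ →
      ∫⁻ b in s, ‖φ b‖ₑ ^ 2 ∂(Measure.euclideanHausdorffMeasure (Module.finrank ℝ E - 1))
        ≤ C * ∫⁻ z in Ω, h1Density φ z) ⟨0, by simp⟩ ?_ ?_ ?_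
  · rintro s t hst ⟨C, hC⟩
    exact ⟨C, fun φ hφ => (lintegral_mono_set hst).trans (hC φ hφ)⟩
  · rintro s t ⟨C, hC⟩ ⟨D, hD⟩
    refine ⟨C + D, fun φ hφ => (lintegral_union_le _ _ _).trans ?_⟩
    rw [ENNReal.coe_add, add_mul]
    exact add_le_add (hC φ hφ) (hD φ hφ)
  · intro x hx
    obtain ⟨ε, hε, C, hC⟩ := exists_lintegral_frontier_inter_ball_le hc ho hne hx
    exact ⟨frontier Ω ∩ Metric.ball x ε,
      inter_mem self_mem_nhdsWithin (mem_nhdsWithin_of_mem_nhds (Metric.ball_mem_nhds x hε)),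
      C, hC⟩

end Trace

/-! ### The trace inequality in `H¹(Ω)` -/

section TraceH1

lemma eLpNorm_two_sq {α F : Type*} [MeasurableSpace α] [NormedAddCommGroup F] (μ : Measure α)
    (f : α → F) : eLpNorm f 2 μ ^ 2 = ∫⁻ x, ‖f x‖ₑ ^ 2 ∂μ := by
  have h := eLpNorm_nnreal_pow_eq_lintegral (μ := μ) (f := f) (p := 2) two_ne_zero
  simpa using h

lemma eLpNorm_two_eq_ofReal_sqrt {α F : Type*} [MeasurableSpace α] [NormedAddCommGroup F]
    {μ : Measure α} {f : α → F} (hf : MemLp f 2 μ) :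
    eLpNorm f 2 μ = ENNReal.ofReal (Real.sqrt (∫ x, ‖f x‖ ^ 2 ∂μ)) := by
  rw [hf.eLpNorm_eq_integral_rpow_norm (by simp) (by simp), Real.sqrt_eq_rpow]
  simp

variable {d : ℕ} {Ω : Set (Euc d)}

lemma gradient_sub_of_contDiff {φ ψ : Euc d → ℝ} (hφ : ContDiff ℝ ∞ φ) (hψ : ContDiff ℝ ∞ ψ)
    (x : Euc d) : gradient (fun z => φ z - ψ z) x = gradient φ x - gradient ψ x := by
  have h1 : fderiv ℝ (fun z => φ z - ψ z) x = fderiv ℝ φ x - fderiv ℝ ψ x :=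
    fderiv_sub (hφ.differentiable (by simp) x) (hψ.differentiable (by simp) x)
  rw [gradient, h1, map_sub]
  rfl

lemma continuous_gradient_of_contDiff {φ : Euc d → ℝ} (hφ : ContDiff ℝ ∞ φ) :
    Continuous (gradient φ) :=
  (InnerProductSpace.toDual ℝ (Euc d)).symm.continuous.comp (hφ.continuous_fderiv (by simp))

/-- The trace operator is compatible with differences. -/
lemma IsTrace.sub {u v h k : Euc d → ℝ} {G H : Euc d → Euc d} (hu : IsTrace Ω u G h)
    (hv : IsTrace Ω v H k) (hum : AEStronglyMeasurable u (domainMeasure Ω))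
    (hvm : AEStronglyMeasurable v (domainMeasure Ω))
    (hGm : AEStronglyMeasurable G (domainMeasure Ω))
    (hHm : AEStronglyMeasurable H (domainMeasure Ω))
    (hhm : AEStronglyMeasurable h (surfaceMeasure Ω))
    (hkm : AEStronglyMeasurable k (surfaceMeasure Ω)) :
    IsTrace Ω (fun x => u x - v x) (fun x => G x - H x) (fun x => h x - k x) := by
  obtain ⟨φ, hφ, ⟨hφ1, hφ2⟩, hφ3⟩ := hu
  obtain ⟨ψ, hψ, ⟨hψ1, hψ2⟩, hψ3⟩ := hv
  have key : ∀ {F : Type} [NormedAddCommGroup F] (μ : Measure (Euc d)) (a b c : ℕ → Euc d → F)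
      (p q : Euc d → F), (∀ n, AEStronglyMeasurable (a n) μ) → (∀ n, AEStronglyMeasurable (b n) μ) →
      AEStronglyMeasurable p μ → AEStronglyMeasurable q μ →
      (∀ n x, c n x = a n x - b n x) →
      Tendsto (fun n => eLpNorm (fun x => a n x - p x) 2 μ) atTop (𝓝 0) →
      Tendsto (fun n => eLpNorm (fun x => b n x - q x) 2 μ) atTop (𝓝 0) →
      Tendsto (fun n => eLpNorm (fun x => c n x - (p x - q x)) 2 μ) atTop (𝓝 0) := by
    intro F _ μ a b c p q ha hb hp hq hc hap hbq
    have hlim := hap.add hbq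
    rw [add_zero] at hlim
    refine tendsto_of_tendsto_of_tendsto_of_le_of_le tendsto_const_nhds hlim
      (fun _ => zero_le) fun n => ?_
    have h1 : (fun x => c n x - (p x - q x)) = (fun x => a n x - p x) - fun x => b n x - q x := by
      ext x
      simp only [Pi.sub_apply, hc]
      abel
    rw [h1]
    exact eLpNorm_sub_le ((ha n).sub hp) ((hb n).sub hq) (by norm_num)
  refine ⟨fun n x => φ n x - ψ n x, fun n => (hφ n).sub (hψ n), ⟨?_, ?_⟩, ?_⟩
  · exact key _ φ ψ _ u v (fun n => (hφ n).continuous.aestronglyMeasurable)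
      (fun n => (hψ n).continuous.aestronglyMeasurable) hum hvm (fun _ _ => rfl) hφ1 hψ1
  · exact key _ (fun n => gradient (φ n)) (fun n => gradient (ψ n)) _ G H
      (fun n => (continuous_gradient_of_contDiff (hφ n)).aestronglyMeasurable)
      (fun n => (continuous_gradient_of_contDiff (hψ n)).aestronglyMeasurable) hGm hHm
      (fun n x => gradient_sub_of_contDiff (hφ n) (hψ n) x) hφ2 hψ2
  · exact key _ φ ψ _ h k (fun n => (hφ n).continuous.aestronglyMeasurable)
      (fun n => (hψ n).continuous.aestronglyMeasurable) hhm hkm (fun _ _ => rfl) hφ3 hψ3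

lemma exists_eLpNorm_surfaceMeasure_le (hΩ : IsAdmissibleDomain Ω) :
    ∃ C : ℝ≥0, ∀ φ : Euc d → ℝ, ContDiff ℝ ∞ φ →
      eLpNorm φ 2 (surfaceMeasure Ω) ≤
        C * (eLpNorm φ 2 (domainMeasure Ω) + eLpNorm (gradient φ) 2 (domainMeasure Ω)) := by
  obtain ⟨C, hC⟩ := exists_lintegral_frontier_le hΩ.convex hΩ.isOpen hΩ.nonempty hΩ.isBounded
  refine ⟨NNReal.sqrt C, fun φ hφ => ?_⟩
  have h := hC φ (hφ.of_le (by simp))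
  rw [finrank_euclideanSpace_fin] at h
  have hgrad : eLpNorm (gradient φ) 2 (domainMeasure Ω) ^ 2
      = ∫⁻ x in Ω, ‖fderiv ℝ φ x‖ₑ ^ 2 := by
    rw [eLpNorm_two_sq]
    refine lintegral_congr fun x => ?_
    rw [← toDual_gradient, LinearIsometryEquiv.enorm_map]
  rw [← ENNReal.pow_le_pow_left_iff two_ne_zero, eLpNorm_two_sq]
  refine h.trans ?_
  have hm : Measurable fun x => ‖φ x‖ₑ ^ 2 := hφ.continuous.enorm.measurable.pow_const 2
  simp only [h1Density]
  rw [lintegral_add_left hm, ← hgrad, ← eLpNorm_two_sq, mul_pow, ← ENNReal.coe_pow, NNReal.sq_sqrt]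
  gcongr
  rw [add_sq]
  gcongr
  exact le_self_add

/-- The trace inequality in `H¹(Ω)`. -/
lemma exists_integral_trace_sub_sq_le (hΩ : IsAdmissibleDomain Ω) :
    ∃ C : ℝ≥0, ∀ u v : H1Function Ω,
      ∫ y, (u.trace y - v.trace y) ^ 2 ∂(surfaceMeasure Ω) ≤ C * h1Dist u v ^ 2 := by
  obtain ⟨C, hC⟩ := exists_eLpNorm_surfaceMeasure_le hΩ
  refine ⟨2 * C ^ 2, fun u v => ?_⟩
  have ha : MemLp (fun x => u.toFun x - v.toFun x) 2 (domainMeasure Ω) :=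
    u.memLp_toFun.sub v.memLp_toFun
  have hG : MemLp (fun x => u.grad x - v.grad x) 2 (domainMeasure Ω) :=
    u.memLp_grad.sub v.memLp_grad
  have ht : MemLp (fun x => u.trace x - v.trace x) 2 (surfaceMeasure Ω) :=
    u.memLp_trace.sub v.memLp_trace
  obtain ⟨φ, hφ, ⟨h1, h2⟩, h3⟩ := u.isTrace.sub v.isTrace u.memLp_toFun.1 v.memLp_toFun.1
    u.memLp_grad.1 v.memLp_grad.1 u.memLp_trace.1 v.memLp_trace.1
  set a := fun x => u.toFun x - v.toFun x
  set G := fun x => u.grad x - v.grad x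
  set t := fun x => u.trace x - v.trace x
  have hbound : eLpNorm t 2 (surfaceMeasure Ω) ≤
      C * (eLpNorm a 2 (domainMeasure Ω) + eLpNorm G 2 (domainMeasure Ω)) := by
    have hlim : Tendsto (fun n =>
        C * ((eLpNorm (fun x => φ n x - a x) 2 (domainMeasure Ω) + eLpNorm a 2 (domainMeasure Ω))
          + (eLpNorm (fun x => gradient (φ n) x - G x) 2 (domainMeasure Ω)
            + eLpNorm G 2 (domainMeasure Ω)))
          + eLpNorm (fun x => φ n x - t x) 2 (surfaceMeasure Ω)) atTop
        (𝓝 (C * ((0 + eLpNorm a 2 (domainMeasure Ω)) + (0 + eLpNorm G 2 (domainMeasure Ω)))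
          + 0)) :=
      (ENNReal.Tendsto.const_mul ((h1.add tendsto_const_nhds).add (h2.add tendsto_const_nhds))
        (Or.inr ENNReal.coe_ne_top)).add h3
    rw [zero_add, zero_add, add_zero] at hlim
    refine ge_of_tendsto' hlim fun n => ?_
    have hφm : ∀ μ : Measure (Euc d), AEStronglyMeasurable (φ n) μ :=
      fun μ => (hφ n).continuous.aestronglyMeasurable
    have hgm := (continuous_gradient_of_contDiff (hφ n)).aestronglyMeasurable
      (μ := domainMeasure Ω)
    have e1 : eLpNorm t 2 (surfaceMeasure Ω) ≤ eLpNorm (φ n) 2 (surfaceMeasure Ω)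
        + eLpNorm (fun x => φ n x - t x) 2 (surfaceMeasure Ω) := by
      have : t = φ n - fun x => φ n x - t x := by ext x; simp
      conv_lhs => rw [this]
      exact eLpNorm_sub_le (hφm _) ((hφm _).sub ht.1) (by norm_num)
    have e2 : eLpNorm (φ n) 2 (domainMeasure Ω) ≤
        eLpNorm (fun x => φ n x - a x) 2 (domainMeasure Ω) + eLpNorm a 2 (domainMeasure Ω) := by
      have : φ n = (fun x => φ n x - a x) + a := by ext x; simp
      conv_lhs => rw [this]
      exact eLpNorm_add_le ((hφm _).sub ha.1) ha.1 (by norm_num)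
    have e3 : eLpNorm (gradient (φ n)) 2 (domainMeasure Ω) ≤
        eLpNorm (fun x => gradient (φ n) x - G x) 2 (domainMeasure Ω)
          + eLpNorm G 2 (domainMeasure Ω) := by
      have : gradient (φ n) = (fun x => gradient (φ n) x - G x) + G := by ext x; simp
      conv_lhs => rw [this]
      exact eLpNorm_add_le (hgm.sub hG.1) hG.1 (by norm_num)
    refine e1.trans (add_le_add_left ((hC _ (hφ n)).trans ?_) _)
    gcongr
  rw [eLpNorm_two_eq_ofReal_sqrt ha, eLpNorm_two_eq_ofReal_sqrt hG, eLpNorm_two_eq_ofReal_sqrt ht,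
    ← ENNReal.ofReal_add (Real.sqrt_nonneg _) (Real.sqrt_nonneg _), ← ENNReal.ofReal_coe_nnreal,
    ← ENNReal.ofReal_mul C.coe_nonneg, ENNReal.ofReal_le_ofReal_iff (by positivity),
    Real.sqrt_le_left (by positivity)] at hbound
  simp only [Real.norm_eq_abs, sq_abs] at hbound
  have hA : 0 ≤ ∫ x in Ω, a x ^ 2 := integral_nonneg fun _ => sq_nonneg _
  have hB : 0 ≤ ∫ x in Ω, ‖G x‖ ^ 2 := integral_nonneg fun _ => sq_nonneg _
  refine hbound.trans ?_
  rw [h1Dist, Real.sq_sqrt (add_nonneg hA hB), mul_pow]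
  calc _ ≤ (C : ℝ) ^ 2 * (2 * (√(∫ x in Ω, a x ^ 2) ^ 2 + √(∫ x in Ω, ‖G x‖ ^ 2) ^ 2)) := by
        gcongr; exact add_sq_le
    _ = _ := by
        rw [Real.sq_sqrt hA, Real.sq_sqrt hB]; push_cast; ring

end TraceH1

/-! ### The energy near the Robin solution -/

section Energy

variable {d : ℕ} {Ω : Set (Euc d)}

lemma integrable_mul_of_memLp_two {μ : Measure (Euc d)} {a b : Euc d → ℝ} (ha : MemLp a 2 μ)
    (hb : MemLp b 2 μ) : Integrable (fun x => a x * b x) μ :=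
  ha.integrable_mul hb

lemma integrable_inner_of_memLp_two {μ : Measure (Euc d)} {a b : Euc d → Euc d} (ha : MemLp a 2 μ)
    (hb : MemLp b 2 μ) : Integrable (fun x => ⟪a x, b x⟫_ℝ) μ := by
  refine Integrable.mono' (ha.norm.integrable_mul hb.norm) (ha.1.inner hb.1)
    (ae_of_all _ fun x => ?_)
  exact norm_inner_le_norm (a x) (b x)

lemma integral_linearCombination_three {μ : Measure (Euc d)} {a b c : Euc d → ℝ}
    (ha : Integrable a μ) (hb : Integrable b μ) (hc : Integrable c μ) (p q r : ℝ) :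
    ∫ x, (p * a x + q * b x + r * c x) ∂μ
      = p * (∫ x, a x ∂μ) + q * (∫ x, b x ∂μ) + r * ∫ x, c x ∂μ := by
  rw [integral_add (f := fun x => p * a x + q * b x)
      ((ha.const_mul p).add (hb.const_mul q)) (hc.const_mul r),
    integral_add (ha.const_mul p) (hb.const_mul q), integral_const_mul, integral_const_mul,
    integral_const_mul]

lemma sq_h1Dist (u v : H1Function Ω) : h1Dist u v ^ 2 =
    (∫ x in Ω, (u.toFun x - v.toFun x) ^ 2) + ∫ x in Ω, ‖u.grad x - v.grad x‖ ^ 2 :=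
  Real.sq_sqrt (add_nonneg (integral_nonneg fun _ => sq_nonneg _)
    (integral_nonneg fun _ => sq_nonneg _))

lemma integrable_sub_sq (u v : H1Function Ω) :
    IntegrableOn (fun x => (u.toFun x - v.toFun x) ^ 2) Ω :=
  (u.memLp_toFun.sub v.memLp_toFun).integrable_sq

lemma integrable_norm_grad_sub_sq (u v : H1Function Ω) :
    IntegrableOn (fun x => ‖u.grad x - v.grad x‖ ^ 2) Ω :=
  (u.memLp_grad.sub v.memLp_grad).norm.integrable_sq

lemma sq_h1Dist_le (u v z : H1Function Ω) :
    h1Dist u z ^ 2 ≤ 2 * h1Dist u v ^ 2 + 2 * h1Dist v z ^ 2 := by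
  have h1 : ∫ x in Ω, (u.toFun x - z.toFun x) ^ 2 ≤
      ∫ x in Ω, (2 * (u.toFun x - v.toFun x) ^ 2 + 2 * (v.toFun x - z.toFun x) ^ 2) := by
    refine integral_mono (integrable_sub_sq u z) (((integrable_sub_sq u v).const_mul 2).add
      ((integrable_sub_sq v z).const_mul 2)) fun x => ?_
    simp only
    nlinarith [sq_nonneg ((u.toFun x - v.toFun x) - (v.toFun x - z.toFun x))]
  have h2 : ∫ x in Ω, ‖u.grad x - z.grad x‖ ^ 2 ≤
      ∫ x in Ω, (2 * ‖u.grad x - v.grad x‖ ^ 2 + 2 * ‖v.grad x - z.grad x‖ ^ 2) := by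
    refine integral_mono (integrable_norm_grad_sub_sq u z)
      (((integrable_norm_grad_sub_sq u v).const_mul 2).add
        ((integrable_norm_grad_sub_sq v z).const_mul 2)) fun x => ?_
    simp only
    have h := norm_sub_le_norm_sub_add_norm_sub (u.grad x) (v.grad x) (z.grad x)
    have h0 := norm_nonneg (u.grad x - z.grad x)
    nlinarith [sq_nonneg (‖u.grad x - v.grad x‖ - ‖v.grad x - z.grad x‖)]
  rw [integral_add ((integrable_sub_sq u v).const_mul 2) ((integrable_sub_sq v z).const_mul 2),
    integral_const_mul, integral_const_mul] at h1
  rw [integral_add ((integrable_norm_grad_sub_sq u v).const_mul 2)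
    ((integrable_norm_grad_sub_sq v z).const_mul 2), integral_const_mul, integral_const_mul] at h2
  rw [sq_h1Dist, sq_h1Dist, sq_h1Dist]
  linarith

variable {f g w : Euc d → ℝ} {cw : ℝ}

lemma AssumptionA.memLp_two_f (hA : AssumptionA Ω f g w cw) (hΩ : IsAdmissibleDomain Ω) :
    MemLp f 2 (domainMeasure Ω) := by
  have : IsFiniteMeasure (domainMeasure Ω) := ⟨by
    rw [Measure.restrict_apply_univ]; exact hΩ.isBounded.measure_lt_top⟩
  exact hA.memLp_f.mono_exponent le_top

lemma AssumptionA.integrable_mul_mul (hA : AssumptionA Ω f g w cw) {a b : Euc d → ℝ}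
    (ha : MemLp a 2 (domainMeasure Ω)) (hb : MemLp b 2 (domainMeasure Ω)) :
    IntegrableOn (fun x => w x * a x * b x) Ω := by
  have hwa : MemLp (fun x => w x * a x) 2 (domainMeasure Ω) := ha.mul hA.memLp_w
  exact hwa.integrable_mul hb

lemma AssumptionA.ae_le_linftyNorm (hA : AssumptionA Ω f g w cw) :
    ∀ᵐ x ∂(domainMeasure Ω), w x ≤ linftyNorm Ω w := by
  filter_upwards [ae_le_eLpNormEssSup (f := w) (μ := domainMeasure Ω)] with x hx
  rw [← eLpNorm_exponent_top] at hx
  have h := ENNReal.toReal_mono hA.memLp_w.2.ne hx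
  rw [toReal_enorm] at h
  exact (le_abs_self _).trans h

/-- The energy is quadratic, and the Robin solution is its critical point: the excess energy of `u`
is half the squared energy norm of `u - u_R`. -/
lemma energy_sub_energy (hΩ : IsAdmissibleDomain Ω) (hA : AssumptionA Ω f g w cw) {α β : ℝ}
    {uR : H1Function Ω} (hR : IsRobinSolution Ω f g w α β uR) (u : H1Function Ω) :
    energy f g w α β u - energy f g w α β uR =
      1 / 2 * (∫ x in Ω, ‖u.grad x - uR.grad x‖ ^ 2)
        + 1 / 2 * (∫ x in Ω, w x * (u.toFun x - uR.toFun x) ^ 2)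
        + 1 / β * (α / 2 * ∫ y, (u.trace y - uR.trace y) ^ 2 ∂(surfaceMeasure Ω)) := by
  have iG : ∀ a b : H1Function Ω, IntegrableOn (fun x => ⟪a.grad x, b.grad x⟫_ℝ) Ω :=
    fun a b => integrable_inner_of_memLp_two a.memLp_grad b.memLp_grad
  have iW : ∀ a b : H1Function Ω, IntegrableOn (fun x => w x * a.toFun x * b.toFun x) Ω :=
    fun a b => hA.integrable_mul_mul a.memLp_toFun b.memLp_toFun
  have iF : ∀ a : H1Function Ω, IntegrableOn (fun x => f x * a.toFun x) Ω :=
    fun a => integrable_mul_of_memLp_two (hA.memLp_two_f hΩ) a.memLp_toFun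
  have iT : ∀ a b : H1Function Ω, Integrable (fun y => a.trace y * b.trace y) (surfaceMeasure Ω) :=
    fun a b => integrable_mul_of_memLp_two a.memLp_trace b.memLp_trace
  have iB : ∀ a : H1Function Ω, Integrable (fun y => g y * a.trace y) (surfaceMeasure Ω) :=
    fun a => integrable_mul_of_memLp_two hA.memHHalf_g.1 a.memLp_trace
  have hE : ∀ a : H1Function Ω, energy f g w α β a =
      1 / 2 * (∫ x in Ω, ⟪a.grad x, a.grad x⟫_ℝ)
        + 1 / 2 * (∫ x in Ω, w x * a.toFun x * a.toFun x) - (∫ x in Ω, f x * a.toFun x)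
        + 1 / β * (α / 2 * (∫ y, a.trace y * a.trace y ∂(surfaceMeasure Ω))
          - ∫ y, g y * a.trace y ∂(surfaceMeasure Ω)) := by
    intro a
    have h1 : ∫ x in Ω, interiorDensity f w a x = 1 / 2 * (∫ x in Ω, ⟪a.grad x, a.grad x⟫_ℝ)
        + 1 / 2 * (∫ x in Ω, w x * a.toFun x * a.toFun x) + (-1) * ∫ x in Ω, f x * a.toFun x := by
      rw [← integral_linearCombination_three (iG a a) (iW a a) (iF a)]
      refine integral_congr_ae (ae_of_all _ fun x => ?_)
      simp only [interiorDensity, real_inner_self_eq_norm_sq]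
      ring
    have h2 : ∫ y, boundaryDensity g α a y ∂(surfaceMeasure Ω) =
        α / 2 * (∫ y, a.trace y * a.trace y ∂(surfaceMeasure Ω))
          - ∫ y, g y * a.trace y ∂(surfaceMeasure Ω) := by
      rw [← integral_const_mul, ← integral_sub ((iT a a).const_mul _) (iB a)]
      refine integral_congr_ae (ae_of_all _ fun y => ?_)
      simp only [boundaryDensity]
      ring
    rw [energy, h1, h2]
    ring
  have sG : ∫ x in Ω, ‖u.grad x - uR.grad x‖ ^ 2 = 1 * (∫ x in Ω, ⟪u.grad x, u.grad x⟫_ℝ)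
      + (-2) * (∫ x in Ω, ⟪uR.grad x, u.grad x⟫_ℝ)
      + 1 * ∫ x in Ω, ⟪uR.grad x, uR.grad x⟫_ℝ := by
    rw [← integral_linearCombination_three (iG u u) (iG uR u) (iG uR uR)]
    refine integral_congr_ae (ae_of_all _ fun x => ?_)
    simp only [norm_sub_sq_real, real_inner_self_eq_norm_sq, real_inner_comm]
    ring
  have sW : ∫ x in Ω, w x * (u.toFun x - uR.toFun x) ^ 2 =
      1 * (∫ x in Ω, w x * u.toFun x * u.toFun x)
      + (-2) * (∫ x in Ω, w x * uR.toFun x * u.toFun x)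
      + 1 * ∫ x in Ω, w x * uR.toFun x * uR.toFun x := by
    rw [← integral_linearCombination_three (iW u u) (iW uR u) (iW uR uR)]
    refine integral_congr_ae (ae_of_all _ fun x => ?_)
    ring
  have sT : ∫ y, (u.trace y - uR.trace y) ^ 2 ∂(surfaceMeasure Ω) =
      1 * (∫ y, u.trace y * u.trace y ∂(surfaceMeasure Ω))
      + (-2) * (∫ y, uR.trace y * u.trace y ∂(surfaceMeasure Ω))
      + 1 * ∫ y, uR.trace y * uR.trace y ∂(surfaceMeasure Ω) := by
    rw [← integral_linearCombination_three (iT u u) (iT uR u) (iT uR uR)]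
    refine integral_congr_ae (ae_of_all _ fun x => ?_)
    ring
  rw [hE, hE, sG, sW, sT]
  linear_combination hR u - hR uR

lemma le_energy_sub_energy (hΩ : IsAdmissibleDomain Ω) (hA : AssumptionA Ω f g w cw) {α β : ℝ}
    (hα : 0 ≤ α) (hβ : 0 < β) {uR : H1Function Ω} (hR : IsRobinSolution Ω f g w α β uR)
    (u : H1Function Ω) :
    min 1 cw / 2 * h1Dist u uR ^ 2 ≤ energy f g w α β u - energy f g w α β uR := by
  have hw : cw * ∫ x in Ω, (u.toFun x - uR.toFun x) ^ 2 ≤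
      ∫ x in Ω, w x * (u.toFun x - uR.toFun x) ^ 2 := by
    rw [← integral_const_mul]
    refine integral_mono_ae ((integrable_sub_sq u uR).const_mul _) ?_ ?_
    · exact (hA.integrable_mul_mul (u.memLp_toFun.sub uR.memLp_toFun)
        (u.memLp_toFun.sub uR.memLp_toFun)).congr (ae_of_all _ fun x => by
          simp only [Pi.sub_apply]; ring)
    · filter_upwards [hA.cw_le] with x hx
      gcongr
  have hT : 0 ≤ 1 / β * (α / 2 * ∫ y, (u.trace y - uR.trace y) ^ 2 ∂(surfaceMeasure Ω)) := by
    have : 0 ≤ ∫ y, (u.trace y - uR.trace y) ^ 2 ∂(surfaceMeasure Ω) :=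
      integral_nonneg fun _ => sq_nonneg _
    exact mul_nonneg (one_div_nonneg.2 hβ.le) (by positivity)
  have h0 : 0 ≤ ∫ x in Ω, (u.toFun x - uR.toFun x) ^ 2 := integral_nonneg fun _ => sq_nonneg _
  have hG : 0 ≤ ∫ x in Ω, ‖u.grad x - uR.grad x‖ ^ 2 := integral_nonneg fun _ => sq_nonneg _
  rw [energy_sub_energy hΩ hA hR, sq_h1Dist]
  nlinarith [mul_le_mul_of_nonneg_right (min_le_right 1 cw) h0,
    mul_le_mul_of_nonneg_right (min_le_left 1 cw) hG]

/-- The excess energy is bounded by the `H¹` distance; the trace inequality, with constant `Ct`,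
controls its boundary part. -/
lemma energy_sub_energy_le (hΩ : IsAdmissibleDomain Ω) (hA : AssumptionA Ω f g w cw) {α β : ℝ}
    (hα : 0 ≤ α) {uR : H1Function Ω} (hR : IsRobinSolution Ω f g w α β uR)
    {Ct : ℝ≥0} (hCt : ∀ u v : H1Function Ω,
      ∫ y, (u.trace y - v.trace y) ^ 2 ∂(surfaceMeasure Ω) ≤ Ct * h1Dist u v ^ 2)
    (u : H1Function Ω) :
    energy f g w α β u - energy f g w α β uR ≤
      max 1 (1 / β) * (max 1 (linftyNorm Ω w) / 2 + α / 2 * Ct) * h1Dist u uR ^ 2 := by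
  have hw : ∫ x in Ω, w x * (u.toFun x - uR.toFun x) ^ 2 ≤
      linftyNorm Ω w * ∫ x in Ω, (u.toFun x - uR.toFun x) ^ 2 := by
    rw [← integral_const_mul]
    refine integral_mono_ae ?_ ((integrable_sub_sq u uR).const_mul _) ?_
    · exact (hA.integrable_mul_mul (u.memLp_toFun.sub uR.memLp_toFun)
        (u.memLp_toFun.sub uR.memLp_toFun)).congr (ae_of_all _ fun x => by
          simp only [Pi.sub_apply]; ring)
    · filter_upwards [hA.ae_le_linftyNorm] with x hx
      gcongr
  have h0 : 0 ≤ ∫ x in Ω, (u.toFun x - uR.toFun x) ^ 2 := integral_nonneg fun _ => sq_nonneg _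
  have hG : 0 ≤ ∫ x in Ω, ‖u.grad x - uR.grad x‖ ^ 2 := integral_nonneg fun _ => sq_nonneg _
  have hI : 1 / 2 * (∫ x in Ω, ‖u.grad x - uR.grad x‖ ^ 2)
      + 1 / 2 * (∫ x in Ω, w x * (u.toFun x - uR.toFun x) ^ 2) ≤
      max 1 (linftyNorm Ω w) / 2 * h1Dist u uR ^ 2 := by
    rw [sq_h1Dist]
    nlinarith [mul_le_mul_of_nonneg_right (le_max_right 1 (linftyNorm Ω w)) h0,
      mul_le_mul_of_nonneg_right (le_max_left 1 (linftyNorm Ω w)) hG]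
  have hI' : max 1 (linftyNorm Ω w) / 2 * h1Dist u uR ^ 2 ≤
      max 1 (1 / β) * (max 1 (linftyNorm Ω w) / 2 * h1Dist u uR ^ 2) :=
    le_mul_of_one_le_left (by positivity) (le_max_left _ _)
  have hB : 1 / β * (α / 2 * ∫ y, (u.trace y - uR.trace y) ^ 2 ∂(surfaceMeasure Ω)) ≤
      max 1 (1 / β) * (α / 2 * (Ct * h1Dist u uR ^ 2)) := by
    have := hCt u uR
    have h1 : 0 ≤ ∫ y, (u.trace y - uR.trace y) ^ 2 ∂(surfaceMeasure Ω) :=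
      integral_nonneg fun _ => sq_nonneg _
    gcongr
    exact le_max_right _ _
  rw [energy_sub_energy hΩ hA hR]
  linarith

end Energy

/-! ### Decomposition of the error -/

section ErrorDecomposition

variable {d : ℕ} {Ω : Set (Euc d)}

/-- The two suprema in the statistical error may be tested at different members of the class. -/
lemma coe_le_statError {P : Set (H1Function Ω)} {L Lhat : H1Function Ω → ℝ} {u v : H1Function Ω}
    (hu : u ∈ P) (hv : v ∈ P) :
    ((L u - Lhat u + (Lhat v - L v) : ℝ) : EReal) ≤ statError P L Lhat := by
  rw [EReal.coe_add]
  exact add_le_add (le_iSup₂_of_le (f := fun u _ => ((L u - Lhat u : ℝ) : EReal)) u hu le_rfl)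
    (le_iSup₂_of_le (f := fun u _ => ((Lhat u - L u : ℝ) : EReal)) v hv le_rfl)

/-- The decomposition of the excess energy of the solver's output `u` into the approximation, the
statistical and the optimization error. -/
lemma coe_sub_le_errors {P : Set (H1Function Ω)} {L Lhat : H1Function Ω → ℝ} {C β : ℝ} (hC : 0 ≤ C)
    {u uhat uR : H1Function Ω} (hu : u ∈ P) (hmin : IsMinOn Lhat P uhat)
    (hL : ∀ v, L v - L uR ≤ max 1 (1 / β) * C * h1Dist v uR ^ 2) :
    ((L u - L uR : ℝ) : EReal) ≤
      (approxError C β P uR : ℝ) + statError P L Lhat + (Lhat u - Lhat uhat : ℝ) := by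
  have hne : Nonempty P := ⟨u, hu⟩
  have hstat : ∀ v ∈ P, ((L u - Lhat u + (Lhat v - L v) : ℝ) : EReal) ≤ statError P L Lhat :=
    fun v hv => coe_le_statError hu hv
  -- Only a finite statistical error needs an argument; it cannot be `-∞` as the class is nonempty.
  generalize statError P L Lhat = e at hstat ⊢
  induction e with
  | bot => exact absurd (hstat u hu) (by simp)
  | top => rw [EReal.coe_add_top, EReal.top_add_coe]; exact le_top
  | coe e =>
    norm_cast at hstat ⊢
    have happ : L u - L uR - e - (Lhat u - Lhat uhat) ≤ approxError C β P uR := by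
      rw [approxError, Real.mul_iInf_of_nonneg (by positivity)]
      refine le_ciInf fun v => ?_
      have h1 := hstat v v.2
      have h2 : Lhat uhat ≤ Lhat v := hmin v.2
      have h3 := hL v
      linarith
    linarith

lemma ofReal_le_mul_sqrtE {C : ℝ≥0} {h a : ℝ} {e : EReal} (hae : (a : EReal) ≤ e)
    (hha : h ^ 2 ≤ (C : ℝ) ^ 2 * a) : ENNReal.ofReal h ≤ C * sqrtE e := by
  have h1 : ENNReal.ofReal (√a) ≤ sqrtE e := by
    rcases le_or_gt a 0 with ha | ha
    · simp [Real.sqrt_eq_zero_of_nonpos ha]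
    rw [sqrtE, Real.sqrt_eq_rpow, ← ENNReal.ofReal_rpow_of_nonneg ha.le (by norm_num),
      ← EReal.real_coe_toENNReal]
    exact ENNReal.rpow_le_rpow (EReal.toENNReal_le_toENNReal hae) (by norm_num)
  have h2 : h ≤ C * √a := by
    refine (Real.le_sqrt_of_sq_le hha).trans_eq ?_
    rw [Real.sqrt_mul (sq_nonneg _), Real.sqrt_sq C.coe_nonneg]
  refine (ENNReal.ofReal_le_ofReal h2).trans ?_
  rw [ENNReal.ofReal_mul C.coe_nonneg, ENNReal.ofReal_coe_nnreal]
  gcongr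

end ErrorDecomposition

end DeepRitz

open DeepRitz
theorem mainTheorem3 :
    -- the constant `C(coe)`, a function of `‖f‖_∞`, `‖g‖_{H^{1/2}}`, `‖w‖_∞` and `c_w` only
    ∃ C : ℝ → ℝ → ℝ → ℝ → ℝ≥0,
    ∀ (d : ℕ) (_ : 1 ≤ d) (Ω : Set (Euc d)) (_ : IsAdmissibleDomain Ω),
    -- the constant `C(Ω, coe, α)`
    ∃ C' : ℝ → ℝ → ℝ → ℝ → ℝ → ℝ≥0,
    ∀ (f g w : Euc d → ℝ) (cw : ℝ) (_ : AssumptionA Ω f g w cw)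
      (α β : ℝ) (_ : 0 ≤ α) (_ : 0 < β)
      (uR : H1Function Ω) (_ : IsRobinSolution Ω f g w α β uR)
      (P : Set (H1Function Ω))
      (S : Type*) [MeasurableSpace S] (Pr : Measure S) [IsProbabilityMeasure Pr]
      (N M : ℕ) (_ : 0 < N) (_ : 0 < M)
      (X : Fin N → S → Euc d) (Y : Fin M → S → Euc d) (_ : IsUniformSample Ω Pr X Y)
      -- the random output `uA` of the solver and a minimizer `uhat` of the empirical energy
      (uA uhat : S → H1Function Ω) (s : S) (_ : uA s ∈ P) (_ : uhat s ∈ P)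
      (_ : IsMinOn (empiricalEnergy f g w α β (fun i => X i s) (fun j => Y j s)) P (uhat s)),
      let L : H1Function Ω → ℝ := energy f g w α β
      let Lhat : H1Function Ω → ℝ :=
        empiricalEnergy f g w α β (fun i => X i s) (fun j => Y j s)
      let Ccoe : ℝ≥0 := C (linftyNorm Ω f) (hHalfNorm Ω g) (linftyNorm Ω w) cw
      let Eapp : ℝ := approxError
        (C' (linftyNorm Ω f) (hHalfNorm Ω g) (linftyNorm Ω w) cw α) β P uR
      let Esta : EReal := statError P L Lhat
      let Eopt : ℝ := Lhat (uA s) - Lhat (uhat s)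
      ENNReal.ofReal (h1Dist (uA s) uR) ≤ Ccoe * sqrtE (Eapp + Esta + Eopt) ∧
      (α = 1 → g =ᵐ[surfaceMeasure Ω] 0 → ∀ uD : H1Function Ω, IsDirichletSolution Ω f w uD →
        ENNReal.ofReal (h1Dist (uA s) uD)
          ≤ Ccoe * sqrtE (Eapp + Esta + Eopt + (h1Dist uR uD ^ 2 : ℝ))) := by
  -- `min 1 c_w / 2` is the coercivity constant; the factor `4` and the summand `2` leave room for
  -- `(a + b)² ≤ 2 a² + 2 b²` in the comparison with the Dirichlet solution.
  refine ⟨fun _ _ _ cw => NNReal.sqrt (Real.toNNReal (4 / min 1 cw + 2)), fun d _ Ω hΩ => ?_⟩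
  obtain ⟨Ct, hCt⟩ := exists_integral_trace_sub_sq_le hΩ
  refine ⟨fun _ _ W _ α => Real.toNNReal (max 1 W / 2 + α / 2 * Ct), ?_⟩
  intro f g w cw hA α β hα hβ uR hR P S _ Pr _ N M _ _ X Y _ uA uhat s huA _ hmin L Lhat Ccoe Eapp
    Esta Eopt
  have hm : 0 < min 1 cw := lt_min one_pos hA.cw_pos
  have hCcoe : (Ccoe : ℝ) ^ 2 = 4 / min 1 cw + 2 := by
    rw [← NNReal.coe_pow, NNReal.sq_sqrt, Real.coe_toNNReal _ (by positivity)]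
  have herr : ((L (uA s) - L uR : ℝ) : EReal) ≤ Eapp + Esta + Eopt := by
    refine coe_sub_le_errors (NNReal.coe_nonneg _) huA hmin fun v => ?_
    rw [Real.coe_toNNReal _ (by positivity)]
    exact energy_sub_energy_le hΩ hA hα hR hCt v
  have hlow := le_energy_sub_energy hΩ hA hα hβ hR (uA s)
  have herr' : ((min 1 cw / 2 * h1Dist (uA s) uR ^ 2 : ℝ) : EReal) ≤ Eapp + Esta + Eopt :=
    (EReal.coe_le_coe_iff.2 hlow).trans herr
  have hcoef : (4 / min 1 cw + 2) * (min 1 cw / 2 * h1Dist (uA s) uR ^ 2)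
      = 2 * h1Dist (uA s) uR ^ 2 + min 1 cw * h1Dist (uA s) uR ^ 2 := by
    field_simp
    ring
  have hpos : 0 ≤ min 1 cw * h1Dist (uA s) uR ^ 2 := by positivity
  refine ⟨ofReal_le_mul_sqrtE herr' ?_, fun _ _ uD _ => ?_⟩
  · rw [hCcoe, hcoef]
    nlinarith [sq_nonneg (h1Dist (uA s) uR)]
  · refine ofReal_le_mul_sqrtE (a := min 1 cw / 2 * h1Dist (uA s) uR ^ 2 + h1Dist uR uD ^ 2) ?_ ?_
    · rw [EReal.coe_add]
      exact add_le_add_left herr' _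
    · rw [hCcoe, mul_add, hcoef]
      have h1 := sq_h1Dist_le (uA s) uR uD
      have h2 : 0 ≤ 4 / min 1 cw * h1Dist uR uD ^ 2 := by positivity
      linarith
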